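/- For $t\ge 1$, let $N$ be a uniformly random open necklace (linear sequence) of $2t$ beads containing exactly two beads of each of $t$ types. A set of cuts between consecutive beads of $N$ is called fair if the resulting intervals can be distributed between two thieves so that each thief gets exactly one bead of each type. Let $X(2,t,1)$ be the minimum number of cuts in a fair set of cuts of $N$. Let $H(x)=-x\log_2 x-(1-x)\log_2(1-x)$ be the binary entropy function and let $H^{-1}$ denote its inverse taking values in $[0,1/2]$. Then, as $t\to\infty$: 1. With probability tending to $1$, $X(2,t,1)\ge 2H^{-1}(1/2)\,t-o(t)$, where $2H^{-1}(1/2)=0.220\ldots$ (that is, $0.220\le 2H^{-1}(1/2)<0.221$). 2. With probability tending to $1$, $X(2,t,1)\le 0.4\,t+o(t)$. (Here $o(t)$ stands for a deterministic function $g(t)$ with $g(t)/t\to0$, possibly a different one in each part.) -/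

import Mathlib

open Filter Topology Asymptotics

/-- Open necklaces of length `k * t * m` with beads of `t` types, exactly `k * m` of each type. -/
abbrev Necklace (k t m : ℕ) : Type :=
  {N : Fin (k * t * m) → Fin t // ∀ i : Fin t, (Finset.univ.filter fun p => N p = i).card = k * m}

/-- The uniform distribution on necklaces. -/
noncomputable def necklaceMeasure (k t m : ℕ) : MeasureTheory.Measure (Necklace k t m) :=
  ProbabilityTheory.uniformOn Set.univ

/-- `C` is a set of cuts of the necklace `N`; the cut `c ∈ C`, `0 < c < k * t * m`, lies between
the beads number `c - 1` and `c` (beads are numbered from `0`). The set is fair if the resulting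
intervals can be distributed among `k` thieves (so that `owner` can only change at a cut) in such
a way that every thief gets exactly `m` beads of each type. -/
def IsFair {k t m : ℕ} (N : Necklace k t m) (C : Finset ℕ) : Prop :=
  C ⊆ Finset.Ioo 0 (k * t * m) ∧
  ∃ owner : Fin (k * t * m) → Fin k,
    (∀ p q : Fin (k * t * m), (q : ℕ) = (p : ℕ) + 1 → (q : ℕ) ∉ C → owner p = owner q) ∧
    ∀ (j : Fin k) (i : Fin t),
      (Finset.univ.filter fun p => owner p = j ∧ N.1 p = i).card = m

/-- The random variable `X(k,t,m)`: the minimum number of cuts in a fair set of cuts. -/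
noncomputable def minCuts {k t m : ℕ} (N : Necklace k t m) : ℕ :=
  sInf {s : ℕ | ∃ C : Finset ℕ, IsFair N C ∧ C.card = s}

/-- A fair set of cuts always exists (cut everywhere), so `minCuts` is a genuine minimum. -/
theorem exists_isFair {k t m : ℕ} (N : Necklace k t m) : ∃ C : Finset ℕ, IsFair N C := by
  have e : ∀ i : Fin t, Nonempty ({p // N.1 p = i} ≃ Fin k × Fin m) := fun i =>
    Fintype.card_eq.1 (by
      rw [Fintype.card_subtype, N.2 i, Fintype.card_prod, Fintype.card_fin, Fintype.card_fin])
  replace e := fun i => Classical.choice (e i)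
  refine ⟨Finset.Ioo 0 (k * t * m), Finset.Subset.refl _,
    fun p => (e (N.1 p) ⟨p, rfl⟩).1, ?_, ?_⟩
  · intro p q hpq hq
    exact absurd (Finset.mem_Ioo.2 ⟨by omega, q.2⟩) hq
  · intro j i
    have key : ∀ (p : Fin (k * t * m)) (h : N.1 p = i),
        (e (N.1 p) ⟨p, rfl⟩).1 = (e i ⟨p, h⟩).1 := by
      rintro p rfl
      rfl
    calc _ = (Finset.univ : Finset (Fin m)).card := by
          symm
          refine Finset.card_bij (fun a _ => ((e i).symm (j, a)).1) ?_ ?_ ?_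
          · intro a _
            have h := ((e i).symm (j, a)).2
            simp only [Finset.mem_filter, Finset.mem_univ, true_and]
            refine ⟨?_, h⟩
            rw [key _ h]
            simp
          · intro a _ b _ hab
            have := (e i).symm.injective (Subtype.ext hab)
            exact (Prod.mk.inj this).2
          · intro p hp
            simp only [Finset.mem_filter, Finset.mem_univ, true_and] at hp
            refine ⟨(e i ⟨p, hp.2⟩).2, Finset.mem_univ _, ?_⟩
            have : (j, (e i ⟨p, hp.2⟩).2) = e i ⟨p, hp.2⟩ :=
              Prod.ext (hp.1.symm.trans (key p hp.2)) rfl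
            simp [this]
      _ = m := by simp

/-- The binary entropy function, with logarithms to base `2`. -/
noncomputable def binaryEntropy (x : ℝ) : ℝ :=
  -x * Real.logb 2 x - (1 - x) * Real.logb 2 (1 - x)

/-- The inverse of the binary entropy function taking values in `[0, 1/2]`. -/
noncomputable def binaryEntropyInv : ℝ → ℝ :=
  Function.invFunOn binaryEntropy (Set.Icc 0 (1 / 2))

theorem binaryEntropy_eq (x : ℝ) : binaryEntropy x = Real.binEntropy x / Real.log 2 := by
  rw [binaryEntropy, Real.binEntropy_eq_negMulLog_add_negMulLog_one_sub, Real.negMulLog,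
    Real.negMulLog, Real.logb, Real.logb]
  ring

/-- The binary entropy function is a bijection from `[0, 1/2]` to `[0, 1]`, so that
`binaryEntropyInv` is its inverse there. -/
theorem binaryEntropy_bijOn :
    Set.BijOn binaryEntropy (Set.Icc 0 (1 / 2)) (Set.Icc 0 1) := by
  have hl : 0 < Real.log 2 := Real.log_pos (by norm_num)
  have hm : StrictMonoOn binaryEntropy (Set.Icc 0 (1 / 2)) := by
    intro x hx y hy hxy
    rw [binaryEntropy_eq, binaryEntropy_eq]
    rw [one_div] at hx hy
    exact div_lt_div_of_pos_right (Real.binEntropy_strictMonoOn hx hy hxy) hl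
  have hc : ContinuousOn binaryEntropy (Set.Icc 0 (1 / 2)) := by
    have : binaryEntropy = fun x => Real.binEntropy x / Real.log 2 := funext binaryEntropy_eq
    rw [this]
    exact (Real.binEntropy_continuous.div_const _).continuousOn
  have h0 : binaryEntropy 0 = 0 := by simp [binaryEntropy_eq]
  have h1 : binaryEntropy (1 / 2) = 1 := by
    rw [binaryEntropy_eq, one_div, Real.binEntropy_two_inv, div_self hl.ne']
  refine ⟨fun x hx => ⟨?_, ?_⟩, hm.injOn, ?_⟩
  · rw [← h0]
    exact hm.monotoneOn ⟨le_rfl, by norm_num⟩ hx hx.1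
  · rw [← h1]
    exact hm.monotoneOn hx ⟨by norm_num, le_rfl⟩ hx.2
  · have := intermediate_value_Icc (by norm_num : (0 : ℝ) ≤ 1 / 2) hc
    rwa [h0, h1] at this

/-! A fair division is a two-colouring of the beads in which each colour class has one bead of each
type; its cost is the number of colour changes.

Upper bound: a uniform necklace with `t + 1` types arises from a uniform one with `t` types by
putting one bead of a new type at the end and the other at a uniform position `p`. Keep an optimal
colouring with `X` changes, and let `r` be its last colour. If the bead at `p` has a neighbour not
coloured `r`, it copies that neighbour, the end bead gets `r`, and nothing is lost. Otherwise one
more cut suffices. Up to a constant there are at most `t - X / 2` bad positions out of `2 * t + 1`,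
so `X` grows on average by about `1 / 2 - X / (4 * t)`, whose equilibrium is `X = 0.4 * t`. A
second-moment recursion (`step_average_le`, `excess_succ_le`) gives the concentration.

Lower bound: each colouring is balanced for at most `t! ^ 2` necklaces, while there are `(2 * t)! /
2 ^ t` necklaces. Weighting colourings by `y ^ changes` (`sum_pow_minCuts_le`) and taking `y = q /
(1 - q)` with `H q = 1 / 2` makes the exponential factors cancel exactly at `2 * q * t` cuts. -/

/-! ### Recursive structure and number of necklaces -/

theorem card_filter_snoc_insertNth {L : ℕ} {α : Type*} (P : α → Prop) [DecidablePred P]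
    (w : Fin L → α) (p : Fin (L + 1)) (x y : α) :
    (Finset.univ.filter fun k : Fin (L + 2) =>
      P (Fin.snoc (α := fun _ => α) (Fin.insertNth (α := fun _ => α) p x w) y k)).card =
    (Finset.univ.filter fun k => P (w k)).card + (if P x then 1 else 0) + if P y then 1 else 0 := by
  simp only [Finset.card_filter]
  rw [Fin.sum_univ_castSucc, Fin.sum_univ_succAbove _ p]
  simp
  ring

/-- Inserting both beads of a new type `x`, one in position `p` and the other one at the end. -/
def insertPair {L t : ℕ} (w : Fin L → Fin t) (x : Fin (t + 1)) (p : Fin (L + 1)) :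
    Fin (L + 2) → Fin (t + 1) :=
  Fin.snoc (α := fun _ => Fin (t + 1))
    (Fin.insertNth (α := fun _ => Fin (t + 1)) p x (x.succAbove ∘ w)) x

theorem card_insertPair_eq {L t : ℕ} (w : Fin L → Fin t) (x i : Fin (t + 1)) (p : Fin (L + 1)) :
    (Finset.univ.filter fun k => insertPair w x p k = i).card =
      (Finset.univ.filter fun k => x.succAbove (w k) = i).card + if x = i then 2 else 0 := by
  have := card_filter_snoc_insertNth (fun z => z = i) (x.succAbove ∘ w) p x x
  rw [insertPair, this]
  split_ifs <;> simp

theorem card_insertPair_self {L t : ℕ} (w : Fin L → Fin t) (x : Fin (t + 1)) (p : Fin (L + 1)) :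
    (Finset.univ.filter fun k => insertPair w x p k = x).card = 2 := by
  rw [card_insertPair_eq]
  simp [Fin.succAbove_ne]

theorem card_insertPair_succAbove {L t : ℕ} (w : Fin L → Fin t) (x : Fin (t + 1))
    (p : Fin (L + 1)) (i : Fin t) :
    (Finset.univ.filter fun k => insertPair w x p k = x.succAbove i).card =
      (Finset.univ.filter fun k => w k = i).card := by
  rw [card_insertPair_eq, if_neg (Fin.succAbove_ne x i).symm]
  simp

theorem insertPair_injective {L t : ℕ} {w w' : Fin L → Fin t} {x x' : Fin (t + 1)}
    {p p' : Fin (L + 1)} (h : insertPair w x p = insertPair w' x' p') :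
    w = w' ∧ x = x' ∧ p = p' := by
  have hx : x = x' := by
    have := congrFun h (Fin.last _)
    simpa [insertPair] using this
  subst hx
  have h1 : ∀ k : Fin (L + 1),
      Fin.insertNth (α := fun _ => Fin (t + 1)) p x (x.succAbove ∘ w) k =
      Fin.insertNth (α := fun _ => Fin (t + 1)) p' x (x.succAbove ∘ w') k := by
    intro k
    have := congrFun h k.castSucc
    simpa [insertPair] using this
  have hp : p = p' := by
    by_contra hne
    obtain ⟨k, hk⟩ := Fin.exists_succAbove_eq hne
    have := h1 p
    rw [← hk, Fin.insertNth_apply_succAbove, hk, Fin.insertNth_apply_same] at this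
    exact Fin.succAbove_ne _ _ this.symm
  subst hp
  refine ⟨?_, rfl, rfl⟩
  funext k
  have := h1 (p.succAbove k)
  simpa using this

theorem exists_eq_insertPair {L t : ℕ} (v : Fin (L + 2) → Fin (t + 1))
    (hv : ∀ i, (Finset.univ.filter fun k => v k = i).card = 2) :
    ∃ (w : Fin L → Fin t) (x : Fin (t + 1)) (p : Fin (L + 1)), v = insertPair w x p := by
  set x := v (Fin.last _) with hx
  have h1 : (Finset.univ.filter fun k : Fin (L + 1) => v k.castSucc = x).card = 1 := by
    have := hv x
    rw [Finset.card_filter, Fin.sum_univ_castSucc, ← hx, if_pos rfl, ← Finset.card_filter] at this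
    omega
  obtain ⟨p, hp⟩ := Finset.card_eq_one.1 h1
  have hp1 : v p.castSucc = x := by
    have : p ∈ (Finset.univ.filter fun k : Fin (L + 1) => v k.castSucc = x) := by simp [hp]
    simpa using this
  have h2 : ∀ k : Fin L, ∃ i, x.succAbove i = v (p.succAbove k).castSucc := by
    intro k
    refine Fin.exists_succAbove_eq fun h => ?_
    have : p.succAbove k ∈ (Finset.univ.filter fun k : Fin (L + 1) => v k.castSucc = x) := by
      simpa using h
    rw [hp, Finset.mem_singleton] at this
    exact Fin.succAbove_ne _ _ this
  choose w hw using h2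
  refine ⟨w, x, p, ?_⟩
  funext k
  refine Fin.lastCases ?_ (fun k => ?_) k
  · simp [insertPair, hx]
  · refine Fin.succAboveCases p ?_ (fun k => ?_) k
    · simp [insertPair, hp1]
    · simp [insertPair, hw]

/-- `insertPair` as an operation on necklaces. -/
def Necklace.insertPair {t : ℕ} (a : Necklace 2 t 1 × Fin (t + 1) × Fin (2 * t * 1 + 1)) :
    Necklace 2 (t + 1) 1 :=
  ⟨_root_.insertPair a.1.1 a.2.1 a.2.2, fun i => by
    by_cases h : i = a.2.1
    · subst h
      exact card_insertPair_self _ _ _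
    · obtain ⟨j, rfl⟩ := Fin.exists_succAbove_eq h
      exact (card_insertPair_succAbove _ _ _ _).trans (a.1.2 j)⟩

/-- The last bead gives the new type, and its twin gives the position. Besides counting necklaces,
this shows that a uniform choice of `(N, x, p)` yields a uniform larger necklace. -/
theorem Necklace.insertPair_bijective {t : ℕ} :
    Function.Bijective (Necklace.insertPair (t := t)) := by
  constructor
  · rintro ⟨N, x, p⟩ ⟨N', x', p'⟩ h
    obtain ⟨h1, h2, h3⟩ := insertPair_injective (congrArg Subtype.val h)
    exact Prod.ext (Subtype.ext h1) (Prod.ext h2 h3)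
  · rintro ⟨v, hv⟩
    obtain ⟨w, x, p, h⟩ := exists_eq_insertPair (L := 2 * t * 1) v hv
    refine ⟨⟨⟨w, fun i => ?_⟩, x, p⟩, Subtype.ext h.symm⟩
    rw [← card_insertPair_succAbove w x p i, ← h]
    exact hv _

theorem Necklace.card_succ (t : ℕ) :
    Fintype.card (Necklace 2 (t + 1) 1) =
      Fintype.card (Necklace 2 t 1) * ((t + 1) * (2 * t + 1)) := by
  rw [← Fintype.card_of_bijective Necklace.insertPair_bijective]
  simp

theorem Necklace.card_mul_two_pow (t : ℕ) :
    Fintype.card (Necklace 2 t 1) * 2 ^ t = (2 * t).factorial := by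
  induction t with
  | zero =>
    have : Fintype.card (Necklace 2 0 1) = 1 :=
      Fintype.card_eq_one_iff.2 ⟨⟨fun p => p.elim0, fun i => i.elim0⟩, fun N =>
        Subtype.ext (funext fun p => p.elim0)⟩
    simp [this]
  | succ t ih =>
    rw [Necklace.card_succ, show 2 * (t + 1) = 2 * t + 1 + 1 by ring, Nat.factorial_succ,
      Nat.factorial_succ, ← ih]
    ring

theorem Necklace.card_pos (t : ℕ) : 0 < Fintype.card (Necklace 2 t 1) := by
  have := Necklace.card_mul_two_pow t
  have h := Nat.factorial_pos (2 * t)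
  rw [← this] at h
  exact Nat.pos_of_mul_pos_right h

/-! ### Fair cuts as balanced colourings -/

/-- The places where the colouring `c` of the first `L` beads changes. -/
def colourChanges {κ : Type*} [DecidableEq κ] (c : ℕ → κ) (L : ℕ) : Finset ℕ :=
  (Finset.Ioo 0 L).filter fun i => c (i - 1) ≠ c i

/-- In each colour class of `c`, the word `w` has exactly one bead of each type. -/
def IsBalanced {κ : Type*} [DecidableEq κ] {L t : ℕ} (w : Fin L → Fin t) (c : ℕ → κ) : Prop :=
  ∀ (j : κ) (i : Fin t), (Finset.univ.filter fun p : Fin L => c p = j ∧ w p = i).card = 1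

theorem minCuts_le_card_colourChanges {t : ℕ} (N : Necklace 2 t 1) {c : ℕ → Fin 2}
    (hc : IsBalanced N.1 c) : minCuts N ≤ (colourChanges c (2 * t * 1)).card := by
  refine Nat.sInf_le ⟨_, ⟨Finset.filter_subset _ _, fun p => c p, ?_, hc⟩, rfl⟩
  intro p q hpq hq
  by_contra h
  refine hq (Finset.mem_filter.2 ⟨Finset.mem_Ioo.2 ⟨by omega, q.2⟩, ?_⟩)
  rwa [hpq, Nat.add_sub_cancel, ← hpq]

/-- The owners in an optimal fair division form the colouring. Its values beyond the necklace are
irrelevant, so any extension to `ℕ` is allowed. -/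
theorem exists_card_colourChanges_le {t : ℕ} (N : Necklace 2 t 1) :
    ∃ o : Fin (2 * t * 1) → Fin 2, ∀ c : ℕ → Fin 2, (∀ p : Fin (2 * t * 1), c p = o p) →
      IsBalanced N.1 c ∧ (colourChanges c (2 * t * 1)).card ≤ minCuts N := by
  obtain ⟨C, ⟨-, o, ho, hb⟩, hC⟩ : minCuts N ∈ {s : ℕ | ∃ C : Finset ℕ, IsFair N C ∧ C.card = s} :=
    Nat.sInf_mem ((exists_isFair N).imp' _ fun C hC => ⟨C, hC, rfl⟩)
  refine ⟨o, fun c hc => ⟨fun j i => by simpa only [hc] using hb j i, ?_⟩⟩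
  rw [← hC]
  refine Finset.card_le_card fun i hi => ?_
  obtain ⟨hi, hne⟩ := Finset.mem_filter.1 hi
  obtain ⟨h0, hL⟩ := Finset.mem_Ioo.1 hi
  by_contra h
  have := ho ⟨i - 1, by omega⟩ ⟨i, hL⟩ (by simp; omega) h
  rw [← hc, ← hc] at this
  exact hne this

/-- The extension of a finite sequence by zeros. -/
def zeroExtend {L n : ℕ} [NeZero n] (o : Fin L → Fin n) (i : ℕ) : Fin n :=
  if h : i < L then o ⟨i, h⟩ else 0

theorem zeroExtend_apply {L n : ℕ} [NeZero n] (o : Fin L → Fin n) (p : Fin L) :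
    zeroExtend o p = o p := by
  simp [zeroExtend]

/-! ### Cost of inserting a pair of beads -/

/-- The colouring of a word of length `L + 2` obtained from the colouring `c` of a word of length
`L` by inserting a bead of colour `a` in position `p` and a bead of colour `b` at the end. -/
def insertColours {κ : Type*} (c : ℕ → κ) (L p : ℕ) (a b : κ) (i : ℕ) : κ :=
  if i < p then c i else if i = p then a else if i ≤ L then c (i - 1) else b

theorem IsBalanced.insertPair {L t : ℕ} {w : Fin L → Fin t} {c : ℕ → Fin 2} (hc : IsBalanced w c)
    (x : Fin (t + 1)) (p : Fin (L + 1)) {a b : Fin 2} (hab : a ≠ b) :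
    IsBalanced (insertPair w x p) (insertColours c L p a b) := by
  intro j i
  have h1 : ∀ k : Fin L, insertColours c L p a b (p.succAbove k) = c k := by
    intro k
    have := k.2
    by_cases h : (k : ℕ) < p
    · rw [Fin.succAbove_of_castSucc_lt _ _ (by simpa [Fin.lt_def] using h)]
      simp [insertColours, h]
    · rw [Fin.succAbove_of_le_castSucc _ _ (by simpa [Fin.le_def] using h)]
      simp only [insertColours, Fin.val_succ]
      rw [if_neg (by omega), if_neg (by omega), if_pos (by omega)]
      simp
  have h2 : insertColours c L p a b (p : ℕ) = a := by simp [insertColours]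
  have h3 : insertColours c L p a b (L + 1) = b := by
    have := p.2
    simp only [insertColours]
    rw [if_neg (by omega), if_neg (by omega), if_neg (by omega)]
  rw [Finset.card_filter, Fin.sum_univ_castSucc, Fin.sum_univ_succAbove _ p]
  simp only [Fin.val_castSucc, Fin.val_last, h1, h2, h3, _root_.insertPair, Fin.snoc_castSucc,
    Fin.snoc_last, Fin.insertNth_apply_same, Fin.insertNth_apply_succAbove, Function.comp]
  by_cases hx : x = i
  · subst hx
    simp only [Fin.succAbove_ne, and_false, if_false, Finset.sum_const_zero, and_true, add_zero]
    fin_cases j <;> fin_cases a <;> fin_cases b <;> simp_all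
  · obtain ⟨l, rfl⟩ := Fin.exists_succAbove_eq (Ne.symm hx)
    simp only [hx, and_false, if_false, zero_add, add_zero, Fin.succAbove_right_inj]
    rw [← Finset.card_filter]
    exact hc j l

/-- A bead that copies a neighbour only lengthens a run, so the old changes are merely shifted; the
only possible new one is before the end bead. -/
theorem colourChanges_insertColours_subset {κ : Type*} [DecidableEq κ] {c : ℕ → κ} {L p : ℕ}
    {a : κ} (hp : p ≤ L) (ha : p < L ∧ a = c p ∨ 0 < p ∧ a = c (p - 1)) (b : κ) :
    ∃ f : ℕ → ℕ, colourChanges (insertColours c L p a b) (L + 2) ⊆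
      insert (L + 1) ((colourChanges c L).image f) := by
  -- `q` is the place between the new bead and the neighbour it copies: no change occurs there, and
  -- later places move by one.
  obtain ⟨q, hq⟩ : ∃ q, (q = p + 1 ∧ p < L ∧ a = c p) ∨ (q = p ∧ 0 < p ∧ a = c (p - 1)) := by
    rcases ha with ha | ha
    · exact ⟨_, Or.inl ⟨rfl, ha⟩⟩
    · exact ⟨_, Or.inr ⟨rfl, ha⟩⟩
  refine ⟨fun i => if i < q then i else i + 1, fun i hi => ?_⟩
  simp only [colourChanges, Finset.mem_filter, Finset.mem_Ioo, Finset.mem_insert,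
    Finset.mem_image] at hi ⊢
  obtain ⟨⟨h0, h1⟩, hi⟩ := hi
  by_cases hL : i = L + 1
  · exact Or.inl hL
  right
  rcases lt_trichotomy i q with h | h | h
  · refine ⟨i, ⟨⟨h0, by omega⟩, ?_⟩, if_pos h⟩
    rcases hq with ⟨hq, hpL, ha⟩ | ⟨hq, hp0, ha⟩
    · simp only [insertColours] at hi
      rw [if_pos (by omega)] at hi
      by_cases h' : i = p
      · subst h'
        simpa [ha] using hi
      · rwa [if_pos (by omega)] at hi
    · simp only [insertColours] at hi
      rwa [if_pos (by omega), if_pos (by omega)] at hi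
  · exfalso
    subst h
    rcases hq with ⟨rfl, hpL, ha⟩ | ⟨rfl, hp0, ha⟩
    · simp only [insertColours] at hi
      simp [ha] at hi
      omega
    · simp only [insertColours] at hi
      rw [if_pos (by omega)] at hi
      simp [ha] at hi
  · refine ⟨i - 1, ⟨⟨by omega, by omega⟩, ?_⟩, by rw [if_neg (by omega)]; omega⟩
    simp only [insertColours] at hi
    rw [if_neg (by omega : ¬ i < p), if_neg (by omega : ¬ i = p), if_pos (by omega : i ≤ L),
      if_neg (by omega : ¬ i - 1 < p)] at hi
    by_cases h' : i - 1 = p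
    · rw [if_pos h'] at hi
      rcases hq with ⟨hq, hpL, ha⟩ | ⟨hq, hp0, ha⟩
      · omega
      · rw [h'] at hi ⊢
        rwa [← ha]
    · rwa [if_neg h', if_pos (by omega)] at hi

theorem card_colourChanges_insertColours_le {κ : Type*} [DecidableEq κ] {c : ℕ → κ} {L p : ℕ}
    {a : κ} (hp : p ≤ L) (ha : p < L ∧ a = c p ∨ 0 < p ∧ a = c (p - 1)) (b : κ) :
    (colourChanges (insertColours c L p a b) (L + 2)).card ≤ (colourChanges c L).card + 1 := by
  obtain ⟨f, hf⟩ := colourChanges_insertColours_subset hp ha b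
  exact (Finset.card_le_card hf).trans
    ((Finset.card_insert_le _ _).trans (Nat.add_le_add_right Finset.card_image_le 1))

theorem card_colourChanges_insertColours_le_of_last {κ : Type*} [DecidableEq κ] {c : ℕ → κ}
    {L p : ℕ} {a : κ} (hp : p < L) (ha : p < L ∧ a = c p ∨ 0 < p ∧ a = c (p - 1)) :
    (colourChanges (insertColours c L p a (c (L - 1))) (L + 2)).card ≤
      (colourChanges c L).card := by
  obtain ⟨f, hf⟩ := colourChanges_insertColours_subset hp.le ha (c (L - 1))
  refine (Finset.card_le_card ((Finset.subset_insert_iff_of_notMem ?_).1 hf)).trans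
    Finset.card_image_le
  rw [colourChanges, Finset.mem_filter, not_and, not_not]
  intro _
  simp only [insertColours]
  rw [if_neg (by omega), if_neg (by omega), if_pos (by omega), if_neg (by omega),
    if_neg (by omega), if_neg (by omega)]
  simp

/-- Double counting over adjacent pairs: with two colours, a pair containing `s` beads of the last
colour contributes exactly `s` to the left side, and each bead lies in at most two pairs. -/
theorem card_repeated_colour_add_le {c : ℕ → Fin 2} {L : ℕ} (hL : 0 < L) :
    2 * ((Finset.Ioo 0 L).filter fun i => c (i - 1) = c (L - 1) ∧ c i = c (L - 1)).card +
      (colourChanges c L).card ≤ 2 * ((Finset.range L).filter fun i => c i = c (L - 1)).card := by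
  obtain ⟨M, rfl⟩ : ∃ M, L = M + 1 := ⟨L - 1, by omega⟩
  have hI : Finset.Ioo 0 (M + 1) = (Finset.range M).map (addRightEmbedding 1) := by
    ext i
    simp only [Finset.mem_Ioo, Finset.mem_map, Finset.mem_range, addRightEmbedding_apply]
    exact ⟨fun h => ⟨i - 1, by omega, by omega⟩, by rintro ⟨k, hk, rfl⟩; omega⟩
  have hz : ((2 * ((Finset.Ioo 0 (M + 1)).filter fun i => c (i - 1) = c M ∧ c i = c M).card +
      (colourChanges c (M + 1)).card : ℕ) : ℤ) ≤
      ((2 * ((Finset.range (M + 1)).filter fun i => c i = c M).card : ℕ) : ℤ) := by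
    rw [colourChanges, hI]
    simp only [Finset.card_filter, Finset.sum_map, addRightEmbedding_apply, Nat.add_sub_cancel]
    push_cast
    have ht := Finset.sum_range_sub (fun i => if c i = c M then (1 : ℤ) else 0) M
    rw [Finset.sum_range_succ', mul_add, Finset.mul_sum, Finset.mul_sum, ← Finset.sum_add_distrib]
    have : ∀ i ∈ Finset.range M, (2 * (if c i = c M ∧ c (i + 1) = c M then (1 : ℤ) else 0) +
        if c i ≠ c (i + 1) then (1 : ℤ) else 0) = 2 * (if c (i + 1) = c M then (1 : ℤ) else 0) -
        ((if c (i + 1) = c M then (1 : ℤ) else 0) - if c i = c M then (1 : ℤ) else 0) := by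
      intro i _
      generalize c i = x
      generalize c (i + 1) = y
      generalize c M = z
      revert x y z
      decide
    rw [Finset.sum_congr rfl this, Finset.sum_sub_distrib, ht]
    simp only [if_true]
    split_ifs <;> linarith
  exact_mod_cast hz

theorem IsBalanced.card_colour {L t : ℕ} {w : Fin L → Fin t} {c : ℕ → Fin 2}
    (hc : IsBalanced w c) (j : Fin 2) : ((Finset.range L).filter fun i => c i = j).card = t := by
  rw [Finset.card_filter, Finset.sum_range (fun i => if c i = j then 1 else 0),
    ← Finset.card_filter, Finset.card_eq_sum_card_fiberwise (f := w) (t := Finset.univ)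
    (fun _ _ => Finset.mem_coe.2 (Finset.mem_univ _))]
  simp only [Finset.filter_filter]
  simp [hc j _]

theorem exists_card_colourChanges_insertColours_le (c : ℕ → Fin 2) {L : ℕ} (hL : 0 < L) :
    ∃ B : Finset (Fin (L + 1)), 2 * B.card + (colourChanges c L).card ≤
        2 * ((Finset.range L).filter fun i => c i = c (L - 1)).card + 4 ∧
      ∀ p : Fin (L + 1), ∃ a b : Fin 2, a ≠ b ∧
        (colourChanges (insertColours c L p a b) (L + 2)).card ≤
          (colourChanges c L).card + if p ∈ B then 1 else 0 := by
  have hR' := card_repeated_colour_add_le (c := c) hL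
  set r := c (L - 1) with hr
  set R := (Finset.Ioo 0 L).filter fun i => c (i - 1) = r ∧ c i = r with hR
  -- Bad positions: both neighbours have the last colour, or a neighbour is missing. The two extreme
  -- positions account for the `4` in the bound.
  set S : Finset ℕ := insert 0 (insert L R) with hS
  have key : ∀ p : ℕ, p ≤ L → ∃ a b : Fin 2, a ≠ b ∧
      (colourChanges (insertColours c L p a b) (L + 2)).card ≤
        (colourChanges c L).card + if p ∈ S then 1 else 0 := by
    intro p hp
    have hne : ∀ a : Fin 2, a ≠ a + 1 := by decide
    split_ifs with hpS
    · by_cases hpL : p < L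
      · exact ⟨c p, c p + 1, hne _,
          card_colourChanges_insertColours_le hp (Or.inl ⟨hpL, rfl⟩) _⟩
      · exact ⟨c (p - 1), c (p - 1) + 1, hne _,
          card_colourChanges_insertColours_le hp (Or.inr ⟨by omega, rfl⟩) _⟩
    · simp only [hS, hR, Finset.mem_insert, Finset.mem_filter, Finset.mem_Ioo, not_or, not_and]
        at hpS
      obtain ⟨hp0, hpL, h⟩ := hpS
      by_cases h1 : c (p - 1) = r
      · exact ⟨c p, r, h ⟨by omega, by omega⟩ h1,
          card_colourChanges_insertColours_le_of_last (by omega) (Or.inl ⟨by omega, rfl⟩)⟩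
      · exact ⟨c (p - 1), r, h1,
          card_colourChanges_insertColours_le_of_last (by omega) (Or.inr ⟨by omega, rfl⟩)⟩
  refine ⟨Finset.univ.filter fun p => (p : ℕ) ∈ S, ?_, fun p => ?_⟩
  · have h1 : (Finset.univ.filter fun p : Fin (L + 1) => (p : ℕ) ∈ S).card ≤ S.card :=
      Finset.card_le_card_of_injOn (fun p => (p : ℕ)) (fun p hp => by simpa using hp)
        Fin.val_injective.injOn
    have h2 : S.card ≤ R.card + 1 + 1 :=
      (Finset.card_insert_le _ _).trans (Nat.add_le_add_right (Finset.card_insert_le _ _) 1)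
    omega
  · simpa using key p (by omega)

/-- When two beads of a new type are inserted into a random necklace, one of them at the end, then
the number of cuts grows at most by one, and it does not grow unless the position of the other bead
is in a set the size of which is controlled by the number of cuts. -/
theorem exists_minCuts_insertPair_le {t : ℕ} (ht : 0 < t) (N : Necklace 2 t 1) :
    ∃ B : Finset (Fin (2 * t * 1 + 1)), 2 * B.card + minCuts N ≤ 2 * t + 4 ∧
      ∀ x p, minCuts (Necklace.insertPair (N, x, p)) ≤ minCuts N + if p ∈ B then 1 else 0 := by
  obtain ⟨o, ho⟩ := exists_card_colourChanges_le N
  obtain ⟨hb, hle⟩ := ho (zeroExtend o) (zeroExtend_apply o)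
  generalize zeroExtend o = c at hb hle
  have hmin := minCuts_le_card_colourChanges N hb
  obtain ⟨B, hB, h⟩ := exists_card_colourChanges_insertColours_le c (L := 2 * t * 1) (by omega)
  rw [hb.card_colour] at hB
  refine ⟨B, by omega, fun x p => ?_⟩
  obtain ⟨a, b, hab, h⟩ := h p
  have h1 : minCuts (Necklace.insertPair (N, x, p)) ≤
      (colourChanges (insertColours c (2 * t * 1) p a b) (2 * (t + 1) * 1)).card :=
    minCuts_le_card_colourChanges _ (hb.insertPair x p hab)
  have h2 : 2 * (t + 1) * 1 = 2 * t * 1 + 2 := by omega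
  rw [h2] at h1
  omega

/-! ### From counting to probability -/

theorem tendsto_necklaceMeasure_one (S : ∀ t : ℕ, Set (Necklace 2 t 1)) (b : ℕ → ℝ)
    (hb : Tendsto b atTop (𝓝 0))
    (h : ∀ᶠ t in atTop, ((S t)ᶜ.ncard : ℝ) ≤ b t * Fintype.card (Necklace 2 t 1)) :
    Tendsto (fun t => necklaceMeasure 2 t 1 (S t)) atTop (𝓝 1) := by
  have h0 : Tendsto (fun t => necklaceMeasure 2 t 1 (S t)ᶜ) atTop (𝓝 0) := by
    refine tendsto_of_tendsto_of_tendsto_of_le_of_le' tendsto_const_nhds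
      (h := fun t => ENNReal.ofReal (b t)) ?_ (Eventually.of_forall fun _ => zero_le) ?_
    · simpa using ENNReal.tendsto_ofReal hb
    · filter_upwards [h] with t ht
      have hc : (0 : ℝ) < Fintype.card (Necklace 2 t 1) := by
        exact_mod_cast Necklace.card_pos t
      rw [necklaceMeasure, ProbabilityTheory.uniformOn_univ,
        MeasureTheory.Measure.count_apply (Set.toFinite _).measurableSet,
        ← (Set.toFinite _).cast_ncard_eq]
      rw [ENNReal.div_le_iff (by exact_mod_cast hc.ne') (by simp)]
      rw [← ENNReal.ofReal_natCast (Fintype.card _), ← ENNReal.ofReal_mul' hc.le]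
      simpa only [ENNReal.ofReal_natCast, ENat.toENNReal_coe] using ENNReal.ofReal_le_ofReal ht
  have h1 : ∀ t, necklaceMeasure 2 t 1 (S t) = 1 - necklaceMeasure 2 t 1 (S t)ᶜ := by
    intro t
    have : Nonempty (Necklace 2 t 1) := Fintype.card_pos_iff.1 (Necklace.card_pos t)
    have : MeasureTheory.IsProbabilityMeasure (necklaceMeasure 2 t 1) := by
      rw [necklaceMeasure]; infer_instance
    rw [← MeasureTheory.prob_compl_eq_one_sub (Set.toFinite _).measurableSet, compl_compl]
  simp only [h1]
  simpa using ENNReal.Tendsto.sub tendsto_const_nhds h0 (Or.inl ENNReal.one_ne_top)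

/-! ### Upper bound by a second-moment recursion -/

/-- Here `D = X - 0.4 * n` and `k` counts bad positions; `D` moves by `0.6` or `-0.4`. For `D ≥ 0`
the cross term `2 * D * (k - 0.4 * (2 * n + 1))` is at most `3.2 * D - D ^ 2 ≤ 2.56`, so the mean
square grows by a bounded amount. -/
theorem step_average_le {n k D : ℝ} (hk0 : 0 ≤ k) (hn : 0 ≤ n) (hk : k ≤ 2 * n + 1)
    (hkD : k ≤ 0.8 * n + 2 - D / 2) :
    k * (max (D + 0.6) 0) ^ 2 + (2 * n + 1 - k) * (max (D - 0.4) 0) ^ 2 ≤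
      (2 * n + 1) * ((max D 0) ^ 2 + 3) := by
  rcases le_total 0 D with hD | hD
  · rw [max_eq_left hD, max_eq_left (by linarith : (0 : ℝ) ≤ D + 0.6)]
    have h1 : (max (D - 0.4) 0) ^ 2 ≤ (D - 0.4) ^ 2 := by
      rcases le_total 0 (D - 0.4) with h | h
      · rw [max_eq_left h]
      · rw [max_eq_right h]; nlinarith [sq_nonneg (D - 0.4)]
    have h2 := mul_le_mul_of_nonneg_left h1 (sub_nonneg.2 hk)
    have h3 := mul_le_mul_of_nonneg_left hkD (by linarith : 0 ≤ 2 * D)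
    nlinarith [sq_nonneg (D - 1.6)]
  · rw [max_eq_right hD, max_eq_right (by linarith : D - 0.4 ≤ (0 : ℝ))]
    have h1 : max (D + 0.6) 0 ≤ 1 := max_le (by linarith) zero_le_one
    have h0 : 0 ≤ max (D + 0.6) 0 := le_max_right _ _
    nlinarith [mul_le_mul_of_nonneg_left (pow_le_one₀ (n := 2) h0 h1) hk0]

/-- The sum over all necklaces of the squared excess of the number of cuts over `0.4 t`. -/
noncomputable def excess (t : ℕ) : ℝ :=
  ∑ N : Necklace 2 t 1, (max ((minCuts N : ℝ) - 0.4 * t) 0) ^ 2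

theorem excess_succ_le {t : ℕ} (ht : 0 < t) :
    excess (t + 1) ≤ (t + 1) * (2 * t + 1) * (excess t + 3 * Fintype.card (Necklace 2 t 1)) := by
  have h1 : ∀ (N : Necklace 2 t 1) (x : Fin (t + 1)), ∑ p : Fin (2 * t * 1 + 1),
      (max ((minCuts (Necklace.insertPair (N, x, p)) : ℝ) - 0.4 * (t + 1 : ℕ)) 0) ^ 2 ≤
      (2 * t + 1) * ((max ((minCuts N : ℝ) - 0.4 * t) 0) ^ 2 + 3) := by
    intro N x
    obtain ⟨B, hB, h⟩ := exists_minCuts_insertPair_le ht N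
    have hcard : B.card ≤ 2 * t + 1 := by simpa using Finset.card_le_univ B
    have hB' : (2 * B.card + minCuts N : ℝ) ≤ 2 * t + 4 := by exact_mod_cast hB
    refine le_trans ?_ (step_average_le (k := B.card) (by positivity) (by positivity)
      (by exact_mod_cast hcard) (by linarith))
    set D := (minCuts N : ℝ) - 0.4 * t with hD
    calc _ ≤ ∑ p : Fin (2 * t * 1 + 1),
          (if p ∈ B then (max (D + 0.6) 0) ^ 2 else (max (D - 0.4) 0) ^ 2) := by
          refine Finset.sum_le_sum fun p _ => ?_
          have hp : (minCuts (Necklace.insertPair (N, x, p)) : ℝ) ≤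
              ((minCuts N + if p ∈ B then 1 else 0 : ℕ) : ℝ) := by exact_mod_cast h x p
          push_cast at hp ⊢
          split_ifs at hp ⊢
          · exact pow_le_pow_left₀ (le_max_right _ _) (max_le_max_right _ (by linarith)) 2
          · exact pow_le_pow_left₀ (le_max_right _ _) (max_le_max_right _ (by linarith)) 2
      _ = _ := by
          rw [Finset.sum_ite, Finset.sum_const, Finset.sum_const, Finset.filter_mem_eq_inter,
            Finset.univ_inter, Finset.filter_notMem_eq_sdiff, nsmul_eq_mul, nsmul_eq_mul,
            Finset.card_sdiff_of_subset (Finset.subset_univ _), Finset.card_univ,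
            Fintype.card_fin, Nat.cast_sub (by omega)]
          push_cast
          ring
  rw [excess, ← Function.Bijective.sum_comp Necklace.insertPair_bijective]
  simp only [Fintype.sum_prod_type]
  calc _ ≤ ∑ N : Necklace 2 t 1, ∑ _x : Fin (t + 1),
        ((2 * t + 1 : ℝ) * ((max ((minCuts N : ℝ) - 0.4 * t) 0) ^ 2 + 3)) :=
        Finset.sum_le_sum fun N _ => Finset.sum_le_sum fun x _ => h1 N x
    _ = _ := by
        simp only [Finset.sum_const, Finset.card_univ, Fintype.card_fin, nsmul_eq_mul, excess,
          ← Finset.mul_sum, Finset.sum_add_distrib]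
        push_cast
        ring

theorem exists_excess_le :
    ∃ M : ℝ, ∀ t : ℕ, 0 < t → excess t ≤ M * t * Fintype.card (Necklace 2 t 1) := by
  -- The `3` absorbs the increment in each step, and `excess 1` starts the induction.
  refine ⟨max 3 (excess 1), fun t ht => ?_⟩
  have hpos : ∀ t, (1 : ℝ) ≤ Fintype.card (Necklace 2 t 1) := fun t => by
    exact_mod_cast Necklace.card_pos t
  induction t, ht using Nat.le_induction with
  | base =>
    have h0 : 0 ≤ max 3 (excess 1) := le_trans (by norm_num) (le_max_left _ _)
    have := mul_le_mul_of_nonneg_left (hpos 1) h0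
    have h1 := le_max_right 3 (excess 1)
    simp only [Nat.succ_eq_add_one, zero_add, Nat.cast_one, mul_one] at this ⊢
    linarith
  | succ t ht ih =>
    refine (excess_succ_le ht).trans ?_
    rw [Necklace.card_succ]
    push_cast
    have h3 := mul_le_mul_of_nonneg_right (le_max_left 3 (excess 1)) (zero_le_one.trans (hpos t))
    calc _ ≤ ((t + 1) * (2 * t + 1) : ℝ) * (max 3 (excess 1) * t * Fintype.card (Necklace 2 t 1) +
          max 3 (excess 1) * Fintype.card (Necklace 2 t 1)) := by gcongr
      _ = _ := by ring

theorem isLittleO_rpow_three_quarters :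
    (fun t : ℕ => (t : ℝ) ^ (3 / 4 : ℝ)) =o[atTop] (fun t : ℕ => (t : ℝ)) := by
  refine Asymptotics.isLittleO_of_tendsto' ?_ ?_
  · filter_upwards [eventually_gt_atTop 0] with t ht h
    exact absurd (by exact_mod_cast h) ht.ne'
  · have := (tendsto_rpow_neg_atTop (show (0 : ℝ) < 1 / 4 by norm_num)).comp
      (tendsto_natCast_atTop_atTop (R := ℝ))
    refine this.congr' ?_
    filter_upwards [eventually_gt_atTop 0] with t ht
    have ht' : (0 : ℝ) < t := by exact_mod_cast ht
    rw [Function.comp, eq_div_iff ht'.ne', ← Real.rpow_add_one ht'.ne']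
    norm_num

theorem tendsto_minCuts_le :
    Tendsto (fun t : ℕ => necklaceMeasure 2 t 1
      {N | (minCuts N : ℝ) ≤ 0.4 * (t : ℝ) + (t : ℝ) ^ (3 / 4 : ℝ)}) atTop (𝓝 1) := by
  obtain ⟨M, hM⟩ := exists_excess_le
  -- Markov's inequality for the squared excess: mean at most `M * t` against the threshold `(t ^ (3
  -- / 4)) ^ 2 = t ^ (3 / 2)`.
  refine tendsto_necklaceMeasure_one _ (fun t => M * (t : ℝ) ^ (-(1 / 2) : ℝ)) ?_ ?_
  · have := (tendsto_rpow_neg_atTop (show (0 : ℝ) < 1 / 2 by norm_num)).comp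
      (tendsto_natCast_atTop_atTop (R := ℝ))
    simpa [Function.comp_def] using this.const_mul M
  · filter_upwards [eventually_gt_atTop 0] with t ht
    have ht' : (0 : ℝ) < t := by exact_mod_cast ht
    have h32 : ((t : ℝ) ^ (3 / 4 : ℝ)) ^ 2 = (t : ℝ) ^ (3 / 2 : ℝ) := by
      rw [← Real.rpow_natCast, ← Real.rpow_mul ht'.le]
      norm_num
    have hsplit : (t : ℝ) = (t : ℝ) ^ (-(1 / 2) : ℝ) * (t : ℝ) ^ (3 / 2 : ℝ) := by
      rw [← Real.rpow_add ht']
      norm_num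
    have hp : 0 < (t : ℝ) ^ (3 / 2 : ℝ) := Real.rpow_pos_of_pos ht' _
    rw [Set.ncard_eq_toFinset_card']
    refine le_of_mul_le_mul_right ?_ hp
    calc _ = ∑ N ∈ ({N : Necklace 2 t 1 | (minCuts N : ℝ) ≤
            0.4 * (t : ℝ) + (t : ℝ) ^ (3 / 4 : ℝ)}ᶜ).toFinset, (t : ℝ) ^ (3 / 2 : ℝ) := by
          rw [Finset.sum_const, nsmul_eq_mul]
      _ ≤ ∑ N ∈ ({N : Necklace 2 t 1 | (minCuts N : ℝ) ≤
            0.4 * (t : ℝ) + (t : ℝ) ^ (3 / 4 : ℝ)}ᶜ).toFinset,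
            (max ((minCuts N : ℝ) - 0.4 * t) 0) ^ 2 := by
          refine Finset.sum_le_sum fun N hN => ?_
          simp only [Set.mem_toFinset, Set.mem_compl_iff, Set.mem_ofPred_eq, not_le] at hN
          rw [← h32]
          exact pow_le_pow_left₀ (by positivity) (le_max_of_le_left (by linarith)) 2
      _ ≤ excess t := Finset.sum_le_univ_sum_of_nonneg fun N => sq_nonneg _
      _ ≤ M * t * Fintype.card (Necklace 2 t 1) := hM t ht
      _ = _ := by
          nth_rewrite 1 [hsplit]
          ring

/-! ### Lower bound by counting colourings -/

open Classical in
-- On each colour class, a balanced word differs from a fixed balanced word `w₀` by a permutation of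
-- the types, so two permutations determine it.
theorem card_isBalanced_le {L t : ℕ} (c : ℕ → Fin 2) :
    (Finset.univ.filter fun w : Fin L → Fin t => IsBalanced w c).card ≤ t.factorial ^ 2 := by
  rcases (Finset.univ.filter fun w : Fin L → Fin t => IsBalanced w c).eq_empty_or_nonempty
    with h | ⟨w₀, hw₀⟩
  · simp [h]
  have h₀ : IsBalanced w₀ c := (Finset.mem_filter.1 hw₀).2
  have hinj : ∀ w : Fin L → Fin t, IsBalanced w c → ∀ p q : Fin L, c p = c q → w p = w q →
      p = q := by
    intro w hw p q hc hpq
    exact Finset.card_le_one.1 (hw (c q) (w q)).le p (by simp [hc, hpq]) q (by simp)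
  have hex : ∀ (j : Fin 2) (i : Fin t), ∃ p : Fin L, c p = j ∧ w₀ p = i := by
    intro j i
    obtain ⟨p, hp⟩ := Finset.card_pos.1 (zero_lt_one.trans_eq (h₀ j i).symm)
    exact ⟨p, by simpa using hp⟩
  choose f hf using hex
  have hperm : ∀ w : Fin L → Fin t, IsBalanced w c → ∀ j,
      ∃ σ : Equiv.Perm (Fin t), ∀ i, σ i = w (f j i) := by
    intro w hw j
    refine ⟨Equiv.ofBijective (fun i => w (f j i)) (Finite.injective_iff_bijective.1 ?_),
      fun i => rfl⟩
    intro i i' h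
    have := hinj w hw _ _ ((hf j i).1.trans (hf j i').1.symm) h
    rw [← (hf j i).2, this, (hf j i').2]
  let g : (Fin L → Fin t) → Fin 2 → Equiv.Perm (Fin t) := fun w =>
    if hw : IsBalanced w c then fun j => (hperm w hw j).choose else 1
  have hg : ∀ w, IsBalanced w c → ∀ p, w p = g w (c p) (w₀ p) := by
    intro w hw p
    simp only [g, dif_pos hw]
    rw [(hperm w hw (c p)).choose_spec]
    exact congrArg w (hinj w₀ h₀ _ _ (hf _ _).1.symm (hf _ _).2.symm)
  calc _ ≤ (Finset.univ : Finset (Fin 2 → Equiv.Perm (Fin t))).card := by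
        refine Finset.card_le_card_of_injOn g (fun _ _ => Finset.mem_coe.2 (Finset.mem_univ _)) ?_
        intro w hw w' hw' h
        simp only [Finset.coe_filter, Finset.mem_univ, true_and, Set.mem_ofPred_eq] at hw hw'
        funext p
        rw [hg w hw, hg w' hw', h]
    _ = _ := by simp [Fintype.card_perm]

theorem zeroExtend_eq_of_colourChanges_eq {L : ℕ} {o o' : Fin L → Fin 2}
    (h0 : zeroExtend o 0 = zeroExtend o' 0)
    (h : colourChanges (zeroExtend o) L = colourChanges (zeroExtend o') L) : o = o' := by
  have key : ∀ i, i < L → zeroExtend o i = zeroExtend o' i := by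
    intro i
    induction i with
    | zero => exact fun _ => h0
    | succ i ih =>
      intro hi
      have h1 := ih (by omega)
      have h2 : i + 1 ∈ colourChanges (zeroExtend o) L ↔
          i + 1 ∈ colourChanges (zeroExtend o') L := by rw [h]
      simp only [colourChanges, Finset.mem_filter, Finset.mem_Ioo, hi, Nat.succ_pos, true_and,
        Nat.add_sub_cancel, h1] at h2
      revert h2
      generalize zeroExtend o' i = x
      generalize zeroExtend o (i + 1) = y
      generalize zeroExtend o' (i + 1) = z
      revert x y z
      decide
  funext p
  rw [← zeroExtend_apply o, ← zeroExtend_apply o', key p p.2]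

/-- A colouring is determined by its first colour and its set of changes, so the binomial theorem
over subsets of `Ioo 0 L` applies. -/
theorem sum_pow_card_colourChanges_le (L : ℕ) {y : ℝ} (hy : 0 ≤ y) :
    ∑ o : Fin L → Fin 2, y ^ (colourChanges (zeroExtend o) L).card ≤ 2 * (1 + y) ^ L := by
  let F : (Fin L → Fin 2) → Fin 2 × Finset ℕ :=
    fun o => (zeroExtend o 0, colourChanges (zeroExtend o) L)
  have hF : Function.Injective F := fun o o' h =>
    zeroExtend_eq_of_colourChanges_eq (congrArg Prod.fst h) (congrArg Prod.snd h)
  calc _ = ∑ a ∈ Finset.univ.image F, y ^ a.2.card := by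
        rw [Finset.sum_image hF.injOn]
    _ ≤ ∑ a ∈ (Finset.univ : Finset (Fin 2)) ×ˢ (Finset.Ioo 0 L).powerset, y ^ a.2.card := by
        refine Finset.sum_le_sum_of_subset_of_nonneg ?_ fun _ _ _ => by positivity
        intro a ha
        obtain ⟨o, -, rfl⟩ := Finset.mem_image.1 ha
        simp [F, colourChanges, Finset.filter_subset]
    _ = 2 * (1 + y) ^ (L - 1) := by
        have := Finset.sum_pow_mul_eq_add_pow y 1 (Finset.Ioo 0 L)
        simp only [one_pow, mul_one, Nat.card_Ioo, Nat.sub_zero] at this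
        rw [Finset.sum_product]
        simp [this, add_comm]
    _ ≤ _ := by
        gcongr
        · linarith
        · omega

theorem sum_pow_minCuts_le (t : ℕ) {y : ℝ} (hy : 0 ≤ y) (hy1 : y ≤ 1) :
    ∑ N : Necklace 2 t 1, y ^ minCuts N ≤ (t.factorial : ℝ) ^ 2 * (2 * (1 + y) ^ (2 * t)) := by
  classical
  calc _ ≤ ∑ N : Necklace 2 t 1, ∑ o : Fin (2 * t * 1) → Fin 2,
          if IsBalanced N.1 (zeroExtend o) then
            y ^ (colourChanges (zeroExtend o) (2 * t * 1)).card else 0 := by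
        refine Finset.sum_le_sum fun N _ => ?_
        obtain ⟨o, ho⟩ := exists_card_colourChanges_le N
        obtain ⟨hb, hle⟩ := ho _ (zeroExtend_apply o)
        refine le_trans ?_ (Finset.single_le_sum (fun o _ => ?_) (Finset.mem_univ o))
        · rw [if_pos hb]
          exact pow_le_pow_of_le_one hy hy1 hle
        · split_ifs <;> positivity
    _ = ∑ o : Fin (2 * t * 1) → Fin 2,
          ((Finset.univ.filter fun N : Necklace 2 t 1 => IsBalanced N.1 (zeroExtend o)).card : ℝ) *
            y ^ (colourChanges (zeroExtend o) (2 * t * 1)).card := by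
        rw [Finset.sum_comm]
        refine Finset.sum_congr rfl fun o _ => ?_
        rw [← Finset.sum_filter, Finset.sum_const, nsmul_eq_mul]
    _ ≤ ∑ o : Fin (2 * t * 1) → Fin 2, (t.factorial : ℝ) ^ 2 *
            y ^ (colourChanges (zeroExtend o) (2 * t * 1)).card := by
        refine Finset.sum_le_sum fun o _ => mul_le_mul_of_nonneg_right ?_ (by positivity)
        have : (Finset.univ.filter fun N : Necklace 2 t 1 =>
            IsBalanced N.1 (zeroExtend o)).card ≤ t.factorial ^ 2 :=
          (Finset.card_le_card_of_injOn Subtype.val (fun N hN => by simpa using hN)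
            Subtype.val_injective.injOn).trans (card_isBalanced_le (L := 2 * t * 1) (zeroExtend o))
        exact_mod_cast this
    _ ≤ _ := by
        rw [← Finset.mul_sum]
        have := sum_pow_card_colourChanges_le (2 * t * 1) hy
        rw [mul_one] at this ⊢
        gcongr

/-- Equivalent to `4 ^ t ≤ (2 * t + 1) * (2 * t).choose t`, by the formula for the number of
necklaces. -/
theorem Necklace.two_pow_mul_factorial_sq_le (t : ℕ) :
    2 ^ t * t.factorial ^ 2 ≤ (2 * t + 1) * Fintype.card (Necklace 2 t 1) := by
  have h1 := Nat.four_pow_le_two_mul_add_one_mul_central_binom t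
  have h2 := Nat.choose_mul_factorial_mul_factorial (show t ≤ 2 * t by omega)
  rw [show 2 * t - t = t by omega, ← Necklace.card_mul_two_pow] at h2
  refine Nat.le_of_mul_le_mul_left ?_ (pow_pos two_pos t)
  calc 2 ^ t * (2 ^ t * t.factorial ^ 2) = 4 ^ t * t.factorial ^ 2 := by
        rw [← mul_assoc, ← mul_pow]
        norm_num
    _ ≤ ((2 * t + 1) * (2 * t).choose t) * t.factorial ^ 2 := Nat.mul_le_mul_right _ h1
    _ = (2 * t + 1) * ((2 * t).choose t * t.factorial * t.factorial) := by ring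
    _ = _ := by rw [h2]; ring

/-! ### Entropy estimates and the Chernoff bound -/

theorem binaryEntropyInv_half_spec :
    binaryEntropyInv (1 / 2) ∈ Set.Icc (0 : ℝ) (1 / 2) ∧
      binaryEntropy (binaryEntropyInv (1 / 2)) = 1 / 2 := by
  have : (1 / 2 : ℝ) ∈ binaryEntropy '' Set.Icc 0 (1 / 2) := by
    rw [binaryEntropy_bijOn.image_eq]
    norm_num
  exact ⟨Function.invFunOn_mem this, Function.invFunOn_eq this⟩

theorem binaryEntropy_strictMonoOn : StrictMonoOn binaryEntropy (Set.Icc 0 (1 / 2)) := by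
  intro x hx y hy hxy
  rw [binaryEntropy_eq, binaryEntropy_eq]
  rw [one_div] at hx hy
  exact div_lt_div_of_pos_right (Real.binEntropy_strictMonoOn hx hy hxy)
    (Real.log_pos one_lt_two)

theorem le_binaryEntropyInv_half : 11 / 100 ≤ binaryEntropyInv (1 / 2) := by
  obtain ⟨hm, he⟩ := binaryEntropyInv_half_spec
  rw [← binaryEntropy_strictMonoOn.le_iff_le ⟨by norm_num, by norm_num⟩ hm, he, binaryEntropy_eq,
    div_le_iff₀ (Real.log_pos one_lt_two), Real.binEntropy]
  -- `H (11 / 100) ≤ 1 / 2`, multiplied by `100` and exponentiated into a rational inequality.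
  have h : Real.log (((11 / 100 : ℝ)⁻¹) ^ 11 * ((1 - 11 / 100 : ℝ)⁻¹) ^ 89) ≤
      Real.log (2 ^ 50) := Real.log_le_log (by norm_num) (by norm_num)
  rw [Real.log_mul (by norm_num) (by norm_num), Real.log_pow, Real.log_pow, Real.log_pow] at h
  push_cast at h
  linarith

theorem binaryEntropyInv_half_lt : binaryEntropyInv (1 / 2) < 12 / 109 := by
  obtain ⟨hm, he⟩ := binaryEntropyInv_half_spec
  rw [← binaryEntropy_strictMonoOn.lt_iff_lt hm ⟨by norm_num, by norm_num⟩, he, binaryEntropy_eq,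
    lt_div_iff₀ (Real.log_pos one_lt_two), Real.binEntropy]
  -- `1 / 2 < H (12 / 109)`, multiplied by `218`. The fraction `12 / 109` lies between the root and
  -- `0.1105`.
  have h : Real.log (2 ^ 109) <
      Real.log (((12 / 109 : ℝ)⁻¹) ^ 24 * ((1 - 12 / 109 : ℝ)⁻¹) ^ 194) :=
    Real.log_lt_log (by norm_num) (by norm_num)
  rw [Real.log_mul (by norm_num) (by norm_num), Real.log_pow, Real.log_pow, Real.log_pow] at h
  push_cast at h
  linarith

/-- After taking logarithms this is the entropy equation. The odds `q / (1 - q)` are the value of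
`y` minimising `(1 + y) ^ 2 / y ^ (2 * q)`. -/
theorem one_add_odds_sq_eq {q : ℝ} (h0 : 0 < q) (h1 : q < 1) (hq : binaryEntropy q = 1 / 2) :
    (1 + q / (1 - q)) ^ 2 / 2 = (q / (1 - q)) ^ (2 * q) := by
  have h1' : 0 < 1 - q := by linarith
  rw [binaryEntropy_eq, div_eq_iff (Real.log_pos one_lt_two).ne', Real.binEntropy, Real.log_inv,
    Real.log_inv] at hq
  have hy : 1 + q / (1 - q) = (1 - q)⁻¹ := by field_simp; ring
  have hy0 : 0 < q / (1 - q) := div_pos h0 h1'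
  refine Real.log_injOn_pos (Set.mem_Ioi.2 (by positivity))
    (Set.mem_Ioi.2 (Real.rpow_pos_of_pos hy0 _)) ?_
  rw [Real.log_rpow hy0, hy, Real.log_div (by positivity) two_ne_zero, Real.log_pow, Real.log_inv,
    Real.log_div h0.ne' h1'.ne']
  push_cast
  linarith

theorem tendsto_mul_rpow_rpow {y : ℝ} (hy0 : 0 < y) (hy1 : y < 1) :
    Tendsto (fun t : ℕ => 2 * (2 * (t : ℝ) + 1) * y ^ ((t : ℝ) ^ (3 / 4 : ℝ))) atTop (𝓝 0) := by
  have ha : 0 < -Real.log y := neg_pos.2 (Real.log_neg hy0 hy1)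
  have hu : Tendsto (fun t : ℕ => (t : ℝ) ^ (3 / 4 : ℝ)) atTop atTop :=
    (tendsto_rpow_atTop (by norm_num)).comp tendsto_natCast_atTop_atTop
  have h1 := (tendsto_rpow_mul_exp_neg_mul_atTop_nhds_zero (4 / 3) _ ha).comp hu
  have h2 := (tendsto_rpow_mul_exp_neg_mul_atTop_nhds_zero 0 _ ha).comp hu
  have h3 := (h1.const_mul 4).add (h2.const_mul 2)
  simp only [mul_zero, add_zero] at h3
  refine h3.congr fun t => ?_
  have : ((t : ℝ) ^ (3 / 4 : ℝ)) ^ (4 / 3 : ℝ) = t := by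
    rw [← Real.rpow_mul (Nat.cast_nonneg t)]
    norm_num
  simp only [Function.comp, this, Real.rpow_zero, Real.rpow_def_of_pos hy0, neg_neg]
  ring

theorem tendsto_le_minCuts :
    Tendsto (fun t : ℕ => necklaceMeasure 2 t 1
      {N | 2 * binaryEntropyInv (1 / 2) * (t : ℝ) - (t : ℝ) ^ (3 / 4 : ℝ) ≤ (minCuts N : ℝ)})
      atTop (𝓝 1) := by
  have hq0 : 0 < binaryEntropyInv (1 / 2) := lt_of_lt_of_le (by norm_num) le_binaryEntropyInv_half
  have hq1 : binaryEntropyInv (1 / 2) < 1 / 2 := binaryEntropyInv_half_lt.trans (by norm_num)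
  have hH := one_add_odds_sq_eq hq0 (by linarith) binaryEntropyInv_half_spec.2
  set q := binaryEntropyInv (1 / 2)
  have hy0 : 0 < q / (1 - q) := div_pos hq0 (by linarith)
  have hy1 : q / (1 - q) < 1 := by rw [div_lt_one] <;> linarith
  set y := q / (1 - q)
  refine tendsto_necklaceMeasure_one _ _ (tendsto_mul_rpow_rpow hy0 hy1)
    (Eventually.of_forall fun t => ?_)
  set g := (t : ℝ) ^ (3 / 4 : ℝ)
  rw [Set.ncard_eq_toFinset_card']
  set S := ({N : Necklace 2 t 1 | 2 * q * (t : ℝ) - g ≤ (minCuts N : ℝ)}ᶜ).toFinset with hS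
  have hp : 0 < y ^ (2 * q * t - g) := Real.rpow_pos_of_pos hy0 _
  -- Since `y < 1`, each necklace with too few cuts has weight `y ^ minCuts N` at least `y ^ (2 * q
  -- * t - g)`.
  refine le_of_mul_le_mul_right ?_ hp
  have hcard : ((2 : ℝ) ^ t * (t.factorial : ℝ) ^ 2) ≤
      (2 * t + 1) * Fintype.card (Necklace 2 t 1) := by
    exact_mod_cast Necklace.two_pow_mul_factorial_sq_le t
  calc (S.card : ℝ) * y ^ (2 * q * t - g) = ∑ N ∈ S, y ^ (2 * q * t - g) := by
        rw [Finset.sum_const, nsmul_eq_mul]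
    _ ≤ ∑ N ∈ S, y ^ minCuts N := by
        refine Finset.sum_le_sum fun N hN => ?_
        simp only [hS, Set.mem_toFinset, Set.mem_compl_iff, Set.mem_ofPred_eq, not_le] at hN
        rw [← Real.rpow_natCast]
        exact Real.rpow_le_rpow_of_exponent_ge hy0 hy1.le hN.le
    _ ≤ ∑ N : Necklace 2 t 1, y ^ minCuts N :=
        Finset.sum_le_univ_sum_of_nonneg fun N => by positivity
    _ ≤ (t.factorial : ℝ) ^ 2 * (2 * (1 + y) ^ (2 * t)) := sum_pow_minCuts_le t hy0.le hy1.le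
    _ = 2 * (2 ^ t * (t.factorial : ℝ) ^ 2) * ((1 + y) ^ 2 / 2) ^ t := by
        rw [div_pow, ← pow_mul]
        field_simp
    _ ≤ 2 * ((2 * t + 1) * Fintype.card (Necklace 2 t 1)) * ((1 + y) ^ 2 / 2) ^ t := by gcongr
    _ = 2 * (2 * t + 1) * (y ^ g * y ^ (2 * q * t - g)) * Fintype.card (Necklace 2 t 1) := by
        rw [← Real.rpow_add hy0, hH, ← Real.rpow_natCast, ← Real.rpow_mul hy0.le,
          add_sub_cancel]
        ring
    _ = _ := by ring

theorem theorem1p4 :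
    (∃ g : ℕ → ℝ, g =o[atTop] (fun t : ℕ => (t : ℝ)) ∧
      Tendsto (fun t : ℕ => necklaceMeasure 2 t 1
        {N | 2 * binaryEntropyInv (1 / 2) * (t : ℝ) - g t ≤ (minCuts N : ℝ)}) atTop (𝓝 1)) ∧
    (0.220 ≤ 2 * binaryEntropyInv (1 / 2) ∧ 2 * binaryEntropyInv (1 / 2) < 0.221) ∧
    (∃ g : ℕ → ℝ, g =o[atTop] (fun t : ℕ => (t : ℝ)) ∧
      Tendsto (fun t : ℕ => necklaceMeasure 2 t 1
        {N | (minCuts N : ℝ) ≤ 0.4 * (t : ℝ) + g t}) atTop (𝓝 1)) :=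
  ⟨⟨_, isLittleO_rpow_three_quarters, tendsto_le_minCuts⟩,
    ⟨by linarith [le_binaryEntropyInv_half], by linarith [binaryEntropyInv_half_lt]⟩,
    ⟨_, isLittleO_rpow_three_quarters, tendsto_minCuts_le⟩⟩
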